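/- Let $\mathfrak{T}$ be the category whose objects are pairs $(X,\mathcal F)$ of a topological space $X$ and a bundle of abelian groups (local coefficient system) $\mathcal F$ on $X$, a morphism $(X_1,\mathcal F_1)\to(X_2,\mathcal F_2)$ being a continuous map $X_1\to X_2$ together with a bundle map $\mathcal F_1\to\mathcal F_2$ covering it that restricts to an isomorphism of abelian groups on each fibre. Let $\mathfrak{C}\subseteq\mathfrak{T}$ be a subcategory such that every morphism of $\mathfrak{T}$ whose target is in $\mathfrak{C}$ is itself in $\mathfrak{C}$. Let $r\colon Y\to X$ be a continuous map of topological spaces and $Z\subseteq X$ a subspace. For $U\subseteq X$ let $\mathrm{hofib}_U(r)$ be the space of pairs $(\gamma,y)$ of a path $\gamma\colon[0,1]\to X$ and a point $y\in Y$ with $\gamma(0)\in U$ and $\gamma(1)=r(y)$ (with the compact-open topology on paths), and write $\mathrm{hofib}_z(r)=\mathrm{hofib}_{\{z\}}(r)$; write $r|_Z\colon r^{-1}(Z)\to Z$ for the restriction of $r$. Then $r^{-1}(U)$ includes into $\mathrm{hofib}_U(r)$ by constant paths. Homology is singular homology with local coefficients. * $r$ is a *Serre $\mathfrak{C}$-homology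 fibration on $Z$* if for every $z\in Z$ and every local coefficient system $\mathcal F$ on $\mathrm{hofib}_z(r)$ with $(\mathrm{hofib}_z(r),\mathcal F)\in\mathfrak{C}$, the natural inclusions $i\colon r^{-1}(z)\to\mathrm{hofib}_z(r|_Z)$ and $j\colon\mathrm{hofib}_z(r|_Z)\to\mathrm{hofib}_z(r)$ are such that $i_*\colon H_*(r^{-1}(z);i^*j^*\mathcal F)\to H_*(\mathrm{hofib}_z(r|_Z);j^*\mathcal F)$ is an isomorphism. * $r$ is a *Leray $\mathfrak{C}$-homology fibration on $Z$* if the topology of $Z$ has a basis $\mathcal B$ of contractible sets such that for all $z\in U\in\mathcal B$ and every local coefficient system $\mathcal F$ on $\mathrm{hofib}_U(r)$ with $(\mathrm{hofib}_U(r),\mathcal F)\in\mathfrak{C}$, the inclusions $i\colon r^{-1}(z)\to r^{-1}(U)$ and $j\colon r^{-1}(U)\to\mathrm{hofib}_U(r)$ are such that $i_*\colon H_*(r^{-1}(z);i^*j^*\mathcal F)\to H_*(r^{-1}(U);j^*\mathcal F)$ is an isomorphism. * $r$ is *locally stalk-like on $\mathfrak{C}$-homology over $Z$* if the topology of $Z$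 has a basis $\mathcal B$ such that each $U\in\mathcal B$ is contractible and contains a point $z_U$ for which, for every local coefficient system $\mathcal F$ on $\mathrm{hofib}_U(r)$ with $(\mathrm{hofib}_U(r),\mathcal F)\in\mathfrak{C}$, the inclusion $r^{-1}(z_U)\to r^{-1}(U)$ induces an isomorphism on homology with coefficients pulled back from $\mathcal F$. **Proposition.** If $r$ is locally stalk-like on $\mathfrak{C}$-homology over $Z$ and is a Serre $\mathfrak{C}$-homology fibration on $Z$, then $r$ is a Leray $\mathfrak{C}$-homology fibration on $Z$. -/

import Mathlib

open CategoryTheory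

universe u

/-! ## Bundles of abelian groups (local coefficient systems) -/

/-- A bundle of abelian groups over `X`: a family of abelian groups `fiber x` with a topology on
the total space, such that `X` is covered by open sets `U` over which the total space is
homeomorphic to `U × A` (with `A` a discrete abelian group) over `U`, by a homeomorphism which is
a group isomorphism on each fibre. -/
structure AbBundle (X : Type u) [TopologicalSpace X] where
  fiber : X → Type u
  [addCommGroup : ∀ x, AddCommGroup (fiber x)]
  [topology : TopologicalSpace (Bundle.TotalSpace PUnit.{u + 1} fiber)]
  continuous_proj :
    Continuous (Bundle.TotalSpace.proj : Bundle.TotalSpace PUnit.{u + 1} fiber → X)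
  locallyTrivial : ∀ x₀ : X, ∃ U : Set X, IsOpen U ∧ x₀ ∈ U ∧
    ∃ (A : Type u) (_ : AddCommGroup A) (_ : TopologicalSpace A) (_ : DiscreteTopology A)
      (φ : ∀ x : U, fiber x ≃+ A),
      Continuous (fun v : {v : Bundle.TotalSpace PUnit.{u + 1} fiber // v.proj ∈ U} =>
        ((⟨v.1.proj, v.2⟩, φ ⟨v.1.proj, v.2⟩ v.1.snd) : U × A)) ∧
      Continuous (fun w : U × A =>
        (⟨w.1, (φ w.1).symm w.2⟩ : Bundle.TotalSpace PUnit.{u + 1} fiber))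

attribute [instance] AbBundle.addCommGroup AbBundle.topology

namespace AbBundle

variable {X : Type u} [TopologicalSpace X]

/-- The total space of a bundle of abelian groups. -/
abbrev Total (F : AbBundle X) : Type u := Bundle.TotalSpace PUnit.{u + 1} F.fiber

/-- The point `v` of the fibre over `x`, as a point of the total space. -/
abbrev pt (F : AbBundle X) (x : X) (v : F.fiber x) : F.Total := ⟨x, v⟩

/-- The topology on the total space of `f^*F`, as a subspace of `W × F`. -/
abbrev pullbackTopology {W : Type u} [TopologicalSpace W] (F : AbBundle X) (f : C(W, X)) :
    TopologicalSpace (Bundle.TotalSpace PUnit.{u + 1} fun w => F.fiber (f w)) :=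
  TopologicalSpace.induced (fun v => ((v.proj, F.pt (f v.proj) v.snd) : W × F.Total)) inferInstance

/-- The pullback `f^*F` of a bundle of abelian groups `F` along a continuous map `f`. -/
def pullback {W : Type u} [TopologicalSpace W] (F : AbBundle X) (f : C(W, X)) : AbBundle W where
  fiber w := F.fiber (f w)
  topology := F.pullbackTopology f
  continuous_proj := by
    let := F.pullbackTopology f
    have hc : Continuous (fun v : Bundle.TotalSpace PUnit.{u + 1} fun w => F.fiber (f w) =>
        ((v.proj, F.pt (f v.proj) v.snd) : W × F.Total)) := continuous_induced_dom
    exact continuous_fst.comp hc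
  locallyTrivial w₀ := by
    obtain ⟨U, hU, hx, A, iA, iT, iD, φ, h₁, h₂⟩ := F.locallyTrivial (f w₀)
    refine ⟨f ⁻¹' U, hU.preimage f.continuous, hx, A, iA, iT, iD,
      fun w => φ ⟨f w, w.2⟩, ?_, ?_⟩
    · let := F.pullbackTopology f
      have hc : Continuous (fun v : Bundle.TotalSpace PUnit.{u + 1} fun w => F.fiber (f w) =>
          ((v.proj, F.pt (f v.proj) v.snd) : W × F.Total)) := continuous_induced_dom
      refine Continuous.prodMk
        ((continuous_fst.comp (hc.comp continuous_subtype_val)).subtype_mk _) ?_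
      exact (continuous_snd.comp h₁).comp
        (((continuous_snd.comp (hc.comp continuous_subtype_val))).subtype_mk fun v => v.2)
    · let := F.pullbackTopology f
      refine continuous_induced_rng.2 (Continuous.prodMk
        (continuous_subtype_val.comp continuous_fst) ?_)
      exact h₂.comp (Continuous.prodMk
        ((f.continuous.comp (continuous_subtype_val.comp continuous_fst)).subtype_mk
          fun w => w.1.2) continuous_snd)

theorem continuous_pt_iff (F : AbBundle X) {K : Type u} [TopologicalSpace K] (σ : C(K, X))
    (s : ∀ t, F.fiber (σ t)) :
    Continuous (fun t => F.pt (σ t) (s t)) ↔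
    ∀ (U : Set X), IsOpen U →
      ∀ (A : Type u) (_ : AddCommGroup A) (_ : TopologicalSpace A) (_ : DiscreteTopology A)
      (φ : ∀ x : U, F.fiber x ≃+ A),
      Continuous (fun v : {v : F.Total // v.proj ∈ U} =>
        ((⟨v.1.proj, v.2⟩, φ ⟨v.1.proj, v.2⟩ v.1.snd) : U × A)) →
      Continuous (fun w : U × A => F.pt w.1 ((φ w.1).symm w.2)) →
      Continuous (fun t : σ ⁻¹' U => φ ⟨σ t, t.2⟩ (s t)) := by
  constructor
  · intro h U _ A _ _ _ φ h₁ _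
    exact (continuous_snd.comp h₁).comp
      ((h.comp continuous_subtype_val).subtype_mk fun t : σ ⁻¹' U => t.2)
  · intro h
    refine continuous_iff_continuousAt.2 fun t₀ => ?_
    obtain ⟨U, hU, hx, A, iA, iT, iD, φ, h₁, h₂⟩ := F.locallyTrivial (σ t₀)
    have hV : IsOpen (σ ⁻¹' U) := hU.preimage σ.continuous
    have hc := h₂.comp (Continuous.prodMk
      ((σ.continuous.comp continuous_subtype_val).subtype_mk fun t : σ ⁻¹' U => t.2)
      (h U hU A iA iT iD φ h₁ h₂))
    have hon : ContinuousOn (fun t => F.pt (σ t) (s t)) (σ ⁻¹' U) := by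
      rw [continuousOn_iff_continuous_domRestrict]
      refine hc.congr fun t => ?_
      simp [pt]
    exact hon.continuousAt (hV.mem_nhds hx)

/-- The group of sections of `F` along `σ : K → X`, i.e. of continuous lifts of `σ` to the total
space of `F`. -/
def sections (F : AbBundle X) {K : Type u} [TopologicalSpace K] (σ : C(K, X)) :
    AddSubgroup (∀ t, F.fiber (σ t)) where
  carrier := {s | Continuous fun t => F.pt (σ t) (s t)}
  add_mem' {a b} ha hb := by
    have ha' := (F.continuous_pt_iff σ a).1 ha
    have hb' := (F.continuous_pt_iff σ b).1 hb
    refine (F.continuous_pt_iff σ _).2 fun U hU A iA iT iD φ h₁ h₂ => ?_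
    refine ((ha' U hU A iA iT iD φ h₁ h₂).add (hb' U hU A iA iT iD φ h₁ h₂)).congr fun t => ?_
    simp
  zero_mem' := by
    refine (F.continuous_pt_iff σ _).2 fun U hU A iA iT iD φ h₁ h₂ => ?_
    refine (continuous_const (y := (0 : A))).congr fun t => ?_
    simp
  neg_mem' {a} ha := by
    have ha' := (F.continuous_pt_iff σ a).1 ha
    refine (F.continuous_pt_iff σ _).2 fun U hU A iA iT iD φ h₁ h₂ => ?_
    refine ((ha' U hU A iA iT iD φ h₁ h₂).neg).congr fun t => ?_
    simp

end AbBundle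

/-! ## The category of spaces with local coefficients -/

/-- A topological space together with a bundle of abelian groups on it. -/
structure CoeffSpace where
  space : TopCat.{u}
  coeff : AbBundle space

namespace CoeffSpace

/-- The pair `(X, F)`. -/
def of {X : Type u} [TopologicalSpace X] (F : AbBundle X) : CoeffSpace.{u} := ⟨TopCat.of X, F⟩

/-- A continuous map together with a bundle map covering it, restricting to an isomorphism of
abelian groups on each fibre. -/
@[ext]
structure Hom (A B : CoeffSpace.{u}) where
  map : C(A.space, B.space)
  fiberMap : ∀ x, A.coeff.fiber x ≃+ B.coeff.fiber (map x)
  continuous_total :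
    Continuous fun v : A.coeff.Total => B.coeff.pt (map v.proj) (fiberMap v.proj v.snd)

instance : Category CoeffSpace.{u} where
  Hom := Hom
  id A := ⟨ContinuousMap.id _, fun _ => AddEquiv.refl _, continuous_id⟩
  comp f g := ⟨g.map.comp f.map, fun x => (f.fiberMap x).trans (g.fiberMap (f.map x)),
    g.continuous_total.comp f.continuous_total⟩

/-- The canonical morphism `(W, f^*F) ⟶ (X, F)` covering `f : W → X`. -/
def pullbackHom {W X : Type u} [TopologicalSpace W] [TopologicalSpace X] (F : AbBundle X)
    (f : C(W, X)) : of (F.pullback f) ⟶ of F where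
  map := f
  fiberMap _ := AddEquiv.refl _
  continuous_total := by
    let := F.pullbackTopology f
    have hc : Continuous (fun v : Bundle.TotalSpace PUnit.{u + 1} fun w => F.fiber (f w) =>
        ((v.proj, F.pt (f v.proj) v.snd) : W × F.Total)) := continuous_induced_dom
    exact continuous_snd.comp hc

/-! ## Singular homology with local coefficients -/

/-- The group `⨁_σ Γ(K; σ^*F)`, the sum running over all continuous `σ : K → X`. For `K` the
standard `n`-simplex this is the group of singular `n`-chains with coefficients in `F`. -/
abbrev Chains (A : CoeffSpace.{u}) (K : TopCat.{u}) : Type u :=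
  DirectSum C(K, A.space) fun σ => A.coeff.sections σ

/-- The section `s ∘ θ` along `σ ∘ θ`, for `s` a section along `σ`. -/
def restrictSection (A : CoeffSpace.{u}) {K L : TopCat.{u}} (θ : L ⟶ K) (σ : C(K, A.space)) :
    A.coeff.sections σ →+ A.coeff.sections (σ.comp θ.hom) where
  toFun s := ⟨fun t => s.1 (θ.hom t), s.2.comp θ.hom.continuous⟩
  map_zero' := rfl
  map_add' _ _ := rfl

/-- The section `f̂ ∘ s` along `f ∘ σ`, for `s` a section along `σ` and `(f, f̂)` a morphism. -/
def pushSection {A B : CoeffSpace.{u}} (f : A ⟶ B) {K : TopCat.{u}} (σ : C(K, A.space)) :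
    A.coeff.sections σ →+ B.coeff.sections (f.map.comp σ) where
  toFun s := ⟨fun t => f.fiberMap (σ t) (s.1 t), f.continuous_total.comp s.2⟩
  map_zero' := by ext t; exact map_zero _
  map_add' a b := by ext t; exact map_add _ _ _

open scoped Classical in
/-- The chain consisting of a single `σ : K → X` with coefficient `s`. -/
noncomputable def Chains.single (A : CoeffSpace.{u}) {K : TopCat.{u}} (σ : C(K, A.space)) :
    A.coeff.sections σ →+ Chains A K :=
  DirectSum.of (fun τ : C(K, A.space) => A.coeff.sections τ) σ

theorem Chains.hom_ext {A : CoeffSpace.{u}} {K : TopCat.{u}} {M : Type u} [AddCommGroup M]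
    {f g : Chains A K →+ M} (h : ∀ σ s, f (Chains.single A σ s) = g (Chains.single A σ s)) :
    f = g := by
  classical
  refine DirectSum.addHom_ext fun σ s => ?_
  convert h σ s using 2 <;> (unfold Chains.single; congr!)

open scoped Classical in
/-- The restriction of chains along `θ : L → K`. -/
noncomputable def Chains.restrict (A : CoeffSpace.{u}) {K L : TopCat.{u}} (θ : L ⟶ K) :
    Chains A K →+ Chains A L :=
  DirectSum.toAddMonoid fun σ => (Chains.single A (σ.comp θ.hom)).comp (restrictSection A θ σ)

open scoped Classical in
/-- The map on chains induced by a morphism `(f, f̂)`. -/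
noncomputable def Chains.push {A B : CoeffSpace.{u}} (f : A ⟶ B) (K : TopCat.{u}) :
    Chains A K →+ Chains B K :=
  DirectSum.toAddMonoid fun σ => (Chains.single B (f.map.comp σ)).comp (pushSection f σ)

theorem Chains.restrict_single (A : CoeffSpace.{u}) {K L : TopCat.{u}} (θ : L ⟶ K)
    (σ : C(K, A.space)) (s : A.coeff.sections σ) :
    Chains.restrict A θ (Chains.single A σ s) =
      Chains.single A (σ.comp θ.hom) (restrictSection A θ σ s) := by
  simp [Chains.restrict, Chains.single]

theorem Chains.push_single {A B : CoeffSpace.{u}} (f : A ⟶ B) {K : TopCat.{u}}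
    (σ : C(K, A.space)) (s : A.coeff.sections σ) :
    Chains.push f K (Chains.single A σ s) =
      Chains.single B (f.map.comp σ) (pushSection f σ s) := by
  simp [Chains.push, Chains.single]

/-- The chains of `(X, F)`, as a contravariant functor of the test space `K`. -/
noncomputable def chainsFunctor (A : CoeffSpace.{u}) : TopCat.{u}ᵒᵖ ⥤ AddCommGrpCat.{u} where
  obj K := AddCommGrpCat.of (Chains A K.unop)
  map θ := AddCommGrpCat.ofHom (Chains.restrict A θ.unop)
  map_id K := by
    ext1
    exact Chains.hom_ext fun σ s => Chains.restrict_single A _ σ s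
  map_comp θ η := by
    ext1
    refine Chains.hom_ext fun σ s => (Chains.restrict_single A _ σ s).trans ?_
    exact (((congrArg _ (Chains.restrict_single A _ σ s))).trans
      (Chains.restrict_single A _ _ _)).symm

/-- The simplicial abelian group of singular chains with local coefficients. -/
noncomputable def singularChains : CoeffSpace.{u} ⥤ SimplicialObject AddCommGrpCat.{u} where
  obj A := SimplexCategory.toTop.{u}.op ⋙ chainsFunctor A
  map {A B} f :=
    { app := fun n => AddCommGrpCat.ofHom (Chains.push f (SimplexCategory.toTop.{u}.obj n.unop))
      naturality := fun m n θ => by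
        ext1
        refine Chains.hom_ext fun σ s => ?_
        exact ((congrArg _ (Chains.restrict_single A _ σ s)).trans
          (Chains.push_single f _ _)).trans
          ((congrArg _ (Chains.push_single f σ s)).trans
            (Chains.restrict_single B _ _ _)).symm }
  map_id A := by
    refine NatTrans.ext (funext fun n => AddCommGrpCat.hom_ext ?_)
    exact Chains.hom_ext fun σ s => Chains.push_single (𝟙 A) σ s
  map_comp f g := by
    refine NatTrans.ext (funext fun n => AddCommGrpCat.hom_ext ?_)
    refine Chains.hom_ext fun σ s => (Chains.push_single (f ≫ g) σ s).trans ?_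
    exact ((congrArg _ (Chains.push_single f σ s)).trans (Chains.push_single g _ _)).symm

/-- The singular homology `H_n(X; F)` with local coefficients. -/
noncomputable def homology (n : ℕ) : CoeffSpace.{u} ⥤ AddCommGrpCat.{u} :=
  singularChains ⋙ AlgebraicTopology.alternatingFaceMapComplex AddCommGrpCat.{u} ⋙
    HomologicalComplex.homologyFunctor AddCommGrpCat.{u} (ComplexShape.down ℕ) n

end CoeffSpace

/-- The map `i : W → X` induces an isomorphism `i_* : H_*(W; i^*G) → H_*(X; G)`. -/
def IsHomologyIso {W X : Type u} [TopologicalSpace W] [TopologicalSpace X] (i : C(W, X))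
    (G : AbBundle X) : Prop :=
  ∀ n : ℕ, IsIso ((CoeffSpace.homology n).map (CoeffSpace.pullbackHom G i))

/-! ## Homotopy fibres -/

section HomotopyFibres

variable {X Y : Type u} [TopologicalSpace X] [TopologicalSpace Y]

/-- The homotopy fibre `hofib_U(r)` over a subset `U`: pairs of a path `γ` in `X` starting in `U`
(with the compact-open topology) and a point `y` of `Y` with `γ(1) = r(y)`. -/
abbrev Hofib (r : C(Y, X)) (U : Set X) : Type u :=
  {p : C(unitInterval, X) × Y // p.1 0 ∈ U ∧ p.1 1 = r p.2}

/-- The natural inclusion `r⁻¹(U) → hofib_U(r)`, by constant paths. -/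
def preimageToHofib (r : C(Y, X)) (U : Set X) : C(r ⁻¹' U, Hofib r U) where
  toFun y := ⟨(ContinuousMap.const unitInterval (r y), y), y.2, rfl⟩
  continuous_toFun := by
    refine Continuous.subtype_mk (Continuous.prodMk ?_ continuous_subtype_val) _
    exact ContinuousMap.continuous_const'.comp (r.continuous.comp continuous_subtype_val)

/-- The natural inclusion `r⁻¹(z) → hofib_z(r|_Z)`, by constant paths, where `r|_Z` is the
restriction `r⁻¹(Z) → Z` of `r`. -/
def fiberToHofibRestrict (r : C(Y, X)) (Z : Set X) (z : Z) :
    C(r ⁻¹' {(z : X)}, Hofib (r.restrictPreimage Z) {z}) where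
  toFun y :=
    ⟨(ContinuousMap.const unitInterval z, ⟨y, by have h : r y = z := y.2; simp [h]⟩),
      rfl, Subtype.ext (show (z : X) = r y from Eq.symm y.2)⟩
  continuous_toFun := by
    refine Continuous.subtype_mk (Continuous.prodMk continuous_const ?_) _
    exact continuous_subtype_val.subtype_mk _

/-- The natural inclusion `hofib_z(r|_Z) → hofib_z(r)`. -/
def hofibRestrictToHofib (r : C(Y, X)) (Z : Set X) (z : Z) :
    C(Hofib (r.restrictPreimage Z) {z}, Hofib r {(z : X)}) where
  toFun p := ⟨((⟨Subtype.val, continuous_subtype_val⟩ : C(Z, X)).comp p.1.1, p.1.2),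
    congrArg Subtype.val p.2.1, congrArg Subtype.val p.2.2⟩
  continuous_toFun := by
    refine Continuous.subtype_mk (Continuous.prodMk ?_ ?_) _
    · exact (ContinuousMap.continuous_postcomp _).comp
        (continuous_fst.comp continuous_subtype_val)
    · exact continuous_subtype_val.comp (continuous_snd.comp continuous_subtype_val)

/-- For `z ∈ U ⊆ Z`, the inclusion `r⁻¹(z) → r⁻¹(U)` of subspaces of `Y`. -/
def fiberToPreimage (r : C(Y, X)) {Z : Set X} {U : Set Z} {z : Z} (hz : z ∈ U) :
    C(r ⁻¹' {(z : X)}, r ⁻¹' (Subtype.val '' U : Set X)) where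
  toFun y := ⟨y, z, hz, Eq.symm y.2⟩
  continuous_toFun := continuous_subtype_val.subtype_mk _

/-! ## Homology fibrations relative to a class `𝔠` of local coefficient systems -/

/-- `r` is a Serre `𝔠`-homology fibration on `Z`. -/
def IsSerreHomologyFibration (𝔠 : ObjectProperty CoeffSpace.{u}) (r : C(Y, X)) (Z : Set X) :
    Prop :=
  ∀ (z : Z) (F : AbBundle (Hofib r {(z : X)})), 𝔠 (CoeffSpace.of F) →
    IsHomologyIso (fiberToHofibRestrict r Z z) (F.pullback (hofibRestrictToHofib r Z z))

/-- `r` is a Leray `𝔠`-homology fibration on `Z`. (The existence of the basis `B` includes the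
local contractibility of `Z`.) -/
def IsLerayHomologyFibration (𝔠 : ObjectProperty CoeffSpace.{u}) (r : C(Y, X)) (Z : Set X) :
    Prop :=
  ∃ B : Set (Set Z), TopologicalSpace.IsTopologicalBasis B ∧ (∀ U ∈ B, ContractibleSpace U) ∧
    ∀ U ∈ B, ∀ (z : Z) (hz : z ∈ U) (F : AbBundle (Hofib r (Subtype.val '' U : Set X))),
      𝔠 (CoeffSpace.of F) →
        IsHomologyIso (fiberToPreimage r hz) (F.pullback (preimageToHofib r (Subtype.val '' U)))

/-- `r` is locally stalk-like on `𝔠`-homology over `Z`. -/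
def IsLocallyStalkLikeOnHomology (𝔠 : ObjectProperty CoeffSpace.{u}) (r : C(Y, X)) (Z : Set X) :
    Prop :=
  ∃ B : Set (Set Z), TopologicalSpace.IsTopologicalBasis B ∧ ∀ U ∈ B, ContractibleSpace U ∧
    ∃ (zU : Z) (hz : zU ∈ U), ∀ F : AbBundle (Hofib r (Subtype.val '' U : Set X)),
      𝔠 (CoeffSpace.of F) →
        IsHomologyIso (fiberToPreimage r hz) (F.pullback (preimageToHofib r (Subtype.val '' U)))

end HomotopyFibres

/-! Fix a basic open set `U` from the stalk-like hypothesis; the same basis serves for the Leray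
condition. Coefficients on r⁻¹(U) that come from hofib_U(r) factor through hofib_U(r|_Z), so it is
enough to compare fibres with that intermediate space. For every z in `U`, the map r⁻¹(z) →
hofib_U(r|_Z) is a homology isomorphism: up to equality of maps it is r⁻¹(z) → hofib_z(r|_Z) →
hofib_U(r|_Z), where the first map is handled by the Serre condition (the coefficients restricted to
hofib_z(r) stay in 𝔠) and the second is a homotopy equivalence because `U` is contractible. It also
factors as r⁻¹(z) → r⁻¹(U) → hofib_U(r|_Z). Cancelling at the special point z_U shows that r⁻¹(U) →
hofib_U(r|_Z) is a homology isomorphism, and cancelling this map at any other z gives the claim.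

Most of the work is homotopy invariance of homology with local coefficients
(`IsHomologyIso.iff_of_homotopic`), from the prism homotopy on a cylinder and parallel transport of
coefficients along a homotopy. The geometric input is `isHomologyIso_hofibInclusion`; the two are
combined in `IsSerreHomologyFibration.isHomologyIso_fiberToPreimage_comp`. -/

/-! ### Simplicial homotopies from families indexed by Δ[1] -/

section SimplicialHomotopy

open SimplexCategory Simplicial Opposite

/-- A family of morphisms `X_n ⟶ Y_n` indexed by the `n`-simplices of `Δ[1]`, natural in `n`,
yields a simplicial homotopy between its values at the two constant simplices. -/
def SimplicialObject.homotopyOfNatural {C : Type*} [Category C] {X Y : SimplicialObject C}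
    (P : ∀ n : SimplexCategory, (n ⟶ ⦋1⦌) → (X.obj (op n) ⟶ Y.obj (op n)))
    (hP : ∀ {m n : SimplexCategory} (α : m ⟶ n) (θ : n ⟶ ⦋1⦌),
      P n θ ≫ Y.map α.op = X.map α.op ≫ P m (α ≫ θ))
    (f g : X ⟶ Y) (hf : ∀ n, f.app (op ⦋n⦌) = P ⦋n⦌ (toMk₁ (Fin.last _)))
    (hg : ∀ n, g.app (op ⦋n⦌) = P ⦋n⦌ (toMk₁ 0)) :
    SimplicialObject.Homotopy f g where
  -- The prism operator: this simplex of Δ[1] is 0 on the vertices 0, …, i and 1 on the later ones.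
  h {n} i := X.σ i ≫ P ⦋n + 1⦌ (toMk₁ i.succ.castSucc)
  h_zero_comp_δ_zero n := by
    rw [hg, Category.assoc, SimplicialObject.δ, hP, ← SimplicialObject.δ,
      δ_comp_toMk₁_of_lt _ _ (by simp)]
    exact X.δ_comp_σ_self_assoc (i := (0 : Fin (n + 1))) _
  h_last_comp_δ_last n := by
    rw [hf, Category.assoc, SimplicialObject.δ, hP, ← SimplicialObject.δ,
      δ_comp_toMk₁_of_le _ _ (by simp)]
    refine (X.δ_comp_σ_succ_assoc (i := Fin.last n) _).trans ?_
    congr 1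
  h_succ_comp_δ_castSucc_of_lt {n} i j hij := by
    rw [Category.assoc, SimplicialObject.δ, hP, ← SimplicialObject.δ,
      ← Category.assoc, X.δ_comp_σ_of_le hij, Category.assoc, δ_comp_toMk₁_of_lt _ _ ?_]
    · congr 3
    · simp only [Fin.lt_def, Fin.le_def, Fin.val_castSucc, Fin.val_succ] at *; omega
  h_succ_comp_δ_castSucc_succ {n} j := by
    simp only [Category.assoc]
    rw [SimplicialObject.δ, hP, hP, ← SimplicialObject.δ, ← Category.assoc, ← Category.assoc]
    have h₁ := X.δ_comp_σ_self (i := j.succ)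
    have h₂ := X.δ_comp_σ_succ (i := j.castSucc)
    rw [Fin.succ_castSucc] at h₂ ⊢
    rw [h₁, h₂, δ_comp_toMk₁_of_lt _ _ (by simp [Fin.lt_def]),
      δ_comp_toMk₁_of_le _ _ (by simp)]
    congr 3
  h_castSucc_comp_δ_succ_of_lt {n} i j hji := by
    rw [Category.assoc, SimplicialObject.δ, hP, ← SimplicialObject.δ,
      ← Category.assoc, X.δ_comp_σ_of_gt hji, Category.assoc, δ_comp_toMk₁_of_le _ _ ?_]
    · congr 3
    · simp only [Fin.lt_def, Fin.le_def, Fin.val_castSucc, Fin.val_succ] at *; omega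
  h_comp_σ_castSucc_of_le {n} i j hij := by
    rw [Category.assoc, SimplicialObject.σ, SimplicialObject.σ, hP, ← SimplicialObject.σ,
      ← SimplicialObject.σ, ← Category.assoc, X.σ_comp_σ hij, Category.assoc]
    rw [σ_comp_toMk₁_of_lt _ _ ?_]
    · rfl
    · simp only [Fin.lt_def, Fin.le_def, Fin.val_castSucc, Fin.val_succ] at *; omega
  h_comp_σ_succ_of_lt {n} i j hji := by
    rw [Category.assoc, SimplicialObject.σ, SimplicialObject.σ, hP, ← SimplicialObject.σ,
      ← SimplicialObject.σ, ← Category.assoc, ← X.σ_comp_σ hji, Category.assoc]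
    rw [σ_comp_toMk₁_of_le _ _ ?_]
    · rfl
    · simp only [Fin.le_def, Fin.val_castSucc, Fin.val_succ] at *; omega

end SimplicialHomotopy

/-! ### The prism homotopy on a cylinder -/

namespace CoeffSpace

/-- The cylinder `X × [0,1]`, with the coefficients pulled back from `X`. -/
def cylinder (A : CoeffSpace.{u}) : CoeffSpace.{u} :=
  of (A.coeff.pullback (ContinuousMap.fst : C(A.space × unitInterval, A.space)))

/-- The map `(σ, a) : K → X × [0,1]`. -/
abbrev cylinderMap (A : CoeffSpace.{u}) {K : TopCat.{u}} (σ : C(K, A.space))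
    (a : C(K, unitInterval)) : C(K, A.cylinder.space) :=
  ContinuousMap.prodMk σ a

/-- The section along `(σ, a) : K → X × [0,1]` given by a section along `σ`. -/
def cylinderSection (A : CoeffSpace.{u}) {K : TopCat.{u}} (a : C(K, unitInterval))
    (σ : C(K, A.space)) :
    A.coeff.sections σ →+ A.cylinder.coeff.sections
      (A.cylinderMap σ a) where
  toFun s := ⟨s.1, by
    let := A.coeff.pullbackTopology (ContinuousMap.fst : C(A.space × unitInterval, A.space))
    exact continuous_induced_rng.2 ((σ.prodMk a).continuous.prodMk s.2)⟩
  map_zero' := rfl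
  map_add' _ _ := rfl

open scoped Classical in
/-- The map from chains of `X` to chains of `X × [0,1]` with prescribed second coordinate. -/
noncomputable def Chains.toCylinder (A : CoeffSpace.{u}) {K : TopCat.{u}}
    (a : C(K, unitInterval)) : Chains A K →+ Chains A.cylinder K :=
  DirectSum.toAddMonoid fun σ =>
    (Chains.single A.cylinder (A.cylinderMap σ a)).comp
      (cylinderSection A a σ)

theorem Chains.toCylinder_single (A : CoeffSpace.{u}) {K : TopCat.{u}} (a : C(K, unitInterval))
    (σ : C(K, A.space)) (s : A.coeff.sections σ) :
    Chains.toCylinder A a (Chains.single A σ s) =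
      Chains.single A.cylinder (A.cylinderMap σ a)
        (cylinderSection A a σ s) := by
  simp [Chains.toCylinder, Chains.single]

/-- This is the naturality that `SimplicialObject.homotopyOfNatural` asks for. -/
theorem Chains.restrict_toCylinder (A : CoeffSpace.{u}) {K L : TopCat.{u}} (θ : L ⟶ K)
    (a : C(K, unitInterval)) :
    (Chains.restrict A.cylinder θ).comp (Chains.toCylinder A a) =
      (Chains.toCylinder A (a.comp θ.hom)).comp (Chains.restrict A θ) := by
  refine Chains.hom_ext fun σ s => ?_
  exact ((congrArg _ (Chains.toCylinder_single A a σ s)).trans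
    (Chains.restrict_single A.cylinder θ _ _)).trans
    ((congrArg _ (Chains.restrict_single A θ σ s)).trans
      (Chains.toCylinder_single A (a.comp θ.hom) (σ.comp θ.hom) _)).symm

/-- The inclusion of `X` into `X × [0,1]` at height `t`. -/
def cylinderInclusion (A : CoeffSpace.{u}) (t : unitInterval) : A ⟶ A.cylinder where
  map := (ContinuousMap.id A.space).prodMk (ContinuousMap.const _ t)
  fiberMap _ := AddEquiv.refl _
  continuous_total := by
    let := A.coeff.pullbackTopology (ContinuousMap.fst : C(A.space × unitInterval, A.space))
    exact continuous_induced_rng.2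
      ((A.coeff.continuous_proj.prodMk continuous_const).prodMk continuous_id)

theorem Chains.push_cylinderInclusion (A : CoeffSpace.{u}) (t : unitInterval) (K : TopCat.{u}) :
    Chains.push (A.cylinderInclusion t) K =
      Chains.toCylinder A (ContinuousMap.const K t) := by
  refine Chains.hom_ext fun σ s => ?_
  exact (Chains.push_single _ σ s).trans (Chains.toCylinder_single A (.const K t) σ s).symm

section

open SimplexCategory Simplicial Opposite

/-- The topological `1`-simplex, mapped to the unit interval. -/
noncomputable def simplexToUnitInterval : C(SimplexCategory.toTop.{u}.obj ⦋1⦌, unitInterval) where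
  toFun x := stdSimplexHomeomorphUnitInterval x.down
  continuous_toFun := stdSimplexHomeomorphUnitInterval.continuous.comp continuous_uliftDown

/-- The point of [0,1] is the barycentric coordinate at vertex 1, here the sum of all coordinates,
since every vertex goes to 1. -/
theorem simplexToUnitInterval_toMk₁_zero (n : ℕ) :
    simplexToUnitInterval.{u}.comp (SimplexCategory.toTop.{u}.map (toMk₁ (n := n) 0)).hom =
      ContinuousMap.const _ 1 := by
  ext x
  refine (FunOnFinite.linearMap_apply_apply ℝ ℝ (toMk₁ (n := n) 0) x.down.1 1).trans ?_
  refine (Finset.sum_congr (Finset.filter_true_of_mem fun i _ => ?_) fun _ _ => rfl).trans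
    (stdSimplex.sum_eq_one x.down)
  exact toMk₁_of_le_castSucc _ _ (by simp)

theorem simplexToUnitInterval_toMk₁_last (n : ℕ) :
    simplexToUnitInterval.{u}.comp
      (SimplexCategory.toTop.{u}.map (toMk₁ (n := n) (Fin.last _))).hom =
      ContinuousMap.const _ 0 := by
  ext x
  refine (FunOnFinite.linearMap_apply_apply ℝ ℝ (toMk₁ (n := n) (Fin.last _)) x.down.1 1).trans ?_
  refine (Finset.sum_congr (Finset.filter_false_of_mem fun i _ => ?_) fun _ _ => rfl).trans
    Finset.sum_empty
  intro h
  have := toMk₁_of_castSucc_lt (n := n) (Fin.last _) i i.castSucc_lt_last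
  exact absurd (this.symm.trans h) (by simp)

/-- The prism homotopy between the inclusions of the two ends of a cylinder. -/
noncomputable def cylinderHomotopy (A : CoeffSpace.{u}) :
    SimplicialObject.Homotopy (singularChains.map (A.cylinderInclusion 0))
      (singularChains.map (A.cylinderInclusion 1)) :=
  SimplicialObject.homotopyOfNatural
    (fun n θ => AddCommGrpCat.ofHom (Chains.toCylinder A (K := SimplexCategory.toTop.{u}.obj n)
      (simplexToUnitInterval.comp (SimplexCategory.toTop.{u}.map θ).hom)))
    (fun {m n} α θ => by
      ext1
      refine (Chains.restrict_toCylinder A (SimplexCategory.toTop.{u}.map α) _).trans ?_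
      rw [SimplexCategory.toTop.{u}.map_comp]
      rfl)
    _ _
    (fun n => by
      ext1
      refine (Chains.push_cylinderInclusion A 0 _).trans ?_
      rw [simplexToUnitInterval_toMk₁_last]
      rfl)
    (fun n => by
      ext1
      refine (Chains.push_cylinderInclusion A 1 _).trans ?_
      rw [simplexToUnitInterval_toMk₁_zero]
      rfl)

theorem homology_map_cylinderInclusion (A : CoeffSpace.{u}) (n : ℕ) :
    (homology n).map (A.cylinderInclusion 0) = (homology n).map (A.cylinderInclusion 1) :=
  (cylinderHomotopy A).map_homology_eq n

end

end CoeffSpace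

/-! ### Bundles of abelian groups as covering spaces -/

namespace AbBundle

variable {X : Type u} [TopologicalSpace X]

/-- The total space of a bundle of abelian groups is a covering space. -/
theorem isCoveringMap (F : AbBundle X) :
    IsCoveringMap (Bundle.TotalSpace.proj : F.Total → X) := by
  intro x
  obtain ⟨U, hU, hx, A, iA, iT, iD, φ, h₁, h₂⟩ := F.locallyTrivial x
  refine IsEvenlyCovered.to_isEvenlyCovered_preimage (I := A)
    ⟨iD, U, hx, hU, hU.preimage F.continuous_proj, ?_⟩
  refine ⟨⟨⟨fun v => (⟨v.1.proj, v.2⟩, φ ⟨v.1.proj, v.2⟩ v.1.snd),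
    fun w => ⟨F.pt w.1 ((φ w.1).symm w.2), w.1.2⟩, fun v => ?_, fun w => ?_⟩, h₁,
    h₂.subtype_mk _⟩, fun _ => rfl⟩
  · simp [pt]
  · simp [pt]

/-- A continuous family of isomorphisms between the fibres of two bundles has continuous
inverse. -/
theorem continuous_symm {F G : AbBundle X} (e : ∀ x, F.fiber x ≃+ G.fiber x)
    (he : Continuous fun v : F.Total => G.pt v.proj (e v.proj v.snd)) :
    Continuous fun v : G.Total => F.pt v.proj ((e v.proj).symm v.snd) := by
  -- A map between covering spaces over the base is a local homeomorphism; being bijective, it is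
  -- then a homeomorphism.
  have hl : IsLocalHomeomorph fun v : F.Total => G.pt v.proj (e v.proj v.snd) :=
    IsLocalHomeomorph.of_comp (g := (Bundle.TotalSpace.proj : G.Total → X))
      F.isCoveringMap.isLocalHomeomorph G.isCoveringMap.isLocalHomeomorph he
  let E : F.Total ≃ G.Total :=
    ⟨fun v => G.pt v.proj (e v.proj v.snd), fun v => F.pt v.proj ((e v.proj).symm v.snd),
      fun v => by simp [pt], fun v => by simp [pt]⟩
  exact (E.toHomeomorphOfContinuousOpen he hl.isOpenMap).symm.continuous

end AbBundle

/-! ### Cancellation for homology isomorphisms -/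

namespace CoeffSpace

/-- The isomorphism of spaces with coefficients given by a continuous family of isomorphisms
between the fibres of two bundles. -/
def isoOfFiberEquiv {X : Type u} [TopologicalSpace X] {F G : AbBundle X}
    (e : ∀ x, F.fiber x ≃+ G.fiber x)
    (he : Continuous fun v : F.Total => G.pt v.proj (e v.proj v.snd)) : of F ≅ of G where
  hom := ⟨ContinuousMap.id X, e, he⟩
  inv := ⟨ContinuousMap.id X, fun x : X => (e x).symm, AbBundle.continuous_symm e he⟩
  hom_inv_id := Hom.ext rfl (heq_of_eq (funext fun x : X => (e x).self_trans_symm))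
  inv_hom_id := Hom.ext rfl (heq_of_eq (funext fun x : X => (e x).symm_trans_self))

/-- The morphism `f` induces an isomorphism on homology. -/
def InducesHomologyIso {A B : CoeffSpace.{u}} (f : A ⟶ B) : Prop :=
  ∀ n : ℕ, IsIso ((homology n).map f)

theorem InducesHomologyIso.comp_iff_right {A B C : CoeffSpace.{u}} {f : A ⟶ B} {g : B ⟶ C}
    (hg : InducesHomologyIso g) : InducesHomologyIso (f ≫ g) ↔ InducesHomologyIso f := by
  refine forall_congr' fun n => ?_
  have := hg n
  rw [Functor.map_comp, isIso_comp_right_iff]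

theorem InducesHomologyIso.comp_iff_left {A B C : CoeffSpace.{u}} {f : A ⟶ B} {g : B ⟶ C}
    (hf : InducesHomologyIso f) : InducesHomologyIso (f ≫ g) ↔ InducesHomologyIso g := by
  refine forall_congr' fun n => ?_
  have := hf n
  rw [Functor.map_comp, isIso_comp_left_iff]

theorem InducesHomologyIso.of_isIso {A B : CoeffSpace.{u}} (f : A ⟶ B) [IsIso f] :
    InducesHomologyIso f := fun _ => inferInstance

/-- The two-out-of-six property. -/
theorem InducesHomologyIso.of_comp_of_comp {A B C D : CoeffSpace.{u}} {f : A ⟶ B} {g : B ⟶ C}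
    {h : C ⟶ D} (hfg : InducesHomologyIso (f ≫ g)) (hgh : InducesHomologyIso (g ≫ h)) :
    InducesHomologyIso h := by
  have hg : InducesHomologyIso g := fun n => by
    have h₁ := hfg n
    have h₂ := hgh n
    rw [Functor.map_comp] at h₁ h₂
    have : IsSplitEpi ((homology n).map g) :=
      ⟨⟨⟨inv ((homology n).map f ≫ (homology n).map g) ≫ (homology n).map f, by simp⟩⟩⟩
    have : Mono ((homology n).map g) := mono_of_mono _ ((homology n).map h)
    exact isIso_of_mono_of_isSplitEpi _
  exact (comp_iff_left hg).1 hgh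

/-- Whether a morphism induces an isomorphism on homology depends only on the underlying map and
the coefficients of the target. -/
theorem inducesHomologyIso_iff {W X : Type u} [TopologicalSpace W] [TopologicalSpace X]
    {F : AbBundle W} {G : AbBundle X} (f : of F ⟶ of G) :
    InducesHomologyIso f ↔ IsHomologyIso (W := W) (X := X) f.map G := by
  let m : C(W, X) := f.map
  let e : ∀ w : W, F.fiber w ≃+ (G.pullback m).fiber w := f.fiberMap
  have he : Continuous fun v : F.Total => (G.pullback m).pt v.proj (e v.proj v.snd) := by
    let := G.pullbackTopology m
    exact continuous_induced_rng.2 (F.continuous_proj.prodMk f.continuous_total)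
  have hf : f = (isoOfFiberEquiv e he).hom ≫ pullbackHom G m := rfl
  have := InducesHomologyIso.comp_iff_left (g := pullbackHom G m)
    (InducesHomologyIso.of_isIso (isoOfFiberEquiv e he).hom)
  rw [← hf] at this
  exact this

end CoeffSpace

namespace IsHomologyIso

open CoeffSpace

variable {V W X : Type u} [TopologicalSpace V] [TopologicalSpace W] [TopologicalSpace X]

/-- The left side uses the coefficients (g ∘ f)^*G, the right side f^*g^*G; `inducesHomologyIso_iff`
absorbs the difference. -/
theorem comp_iff (f : C(V, W)) (g : C(W, X)) (G : AbBundle X) :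
    IsHomologyIso (g.comp f) G ↔
      InducesHomologyIso (pullbackHom (G.pullback g) f ≫ pullbackHom G g) :=
  (inducesHomologyIso_iff (pullbackHom (G.pullback g) f ≫ pullbackHom G g)).symm

theorem comp_iff_right {f : C(V, W)} {g : C(W, X)} {G : AbBundle X} (hg : IsHomologyIso g G) :
    IsHomologyIso (g.comp f) G ↔ IsHomologyIso f (G.pullback g) :=
  (comp_iff f g G).trans (InducesHomologyIso.comp_iff_right hg)

theorem comp_iff_left {f : C(V, W)} {g : C(W, X)} {G : AbBundle X}
    (hf : IsHomologyIso f (G.pullback g)) :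
    IsHomologyIso (g.comp f) G ↔ IsHomologyIso g G :=
  (comp_iff f g G).trans (InducesHomologyIso.comp_iff_left hf)

theorem id (G : AbBundle X) : IsHomologyIso (ContinuousMap.id X) G :=
  (inducesHomologyIso_iff (𝟙 (of G))).1 (InducesHomologyIso.of_isIso _)

/-- Isomorphic coefficients give equivalent conditions. -/
theorem congr_coeff (f : C(W, X)) {F G : AbBundle X} (e : ∀ x, F.fiber x ≃+ G.fiber x)
    (he : Continuous fun v : F.Total => G.pt v.proj (e v.proj v.snd)) :
    IsHomologyIso f F ↔ IsHomologyIso f G :=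
  (InducesHomologyIso.comp_iff_right
    (InducesHomologyIso.of_isIso (isoOfFiberEquiv e he).hom)).symm.trans
    (inducesHomologyIso_iff (pullbackHom F f ≫ (isoOfFiberEquiv e he).hom))

/-- The fibres agree definitionally, but the topologies of the total spaces are induced along
different maps, so continuity of the identity needs an argument. -/
theorem pullback_comp_iff {T : Type u} [TopologicalSpace T] (i : C(T, V)) (f : C(V, W))
    (g : C(W, X)) (G : AbBundle X) :
    IsHomologyIso i (G.pullback (g.comp f)) ↔ IsHomologyIso i ((G.pullback g).pullback f) := by
  refine congr_coeff i (F := G.pullback (g.comp f)) (G := (G.pullback g).pullback f)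
    (fun _ => AddEquiv.refl _) ?_
  let := G.pullbackTopology (g.comp f)
  let := G.pullbackTopology g
  let := (G.pullback g).pullbackTopology f
  have hp := (G.pullback (g.comp f)).continuous_proj
  exact continuous_induced_rng.2 (hp.prodMk (continuous_induced_rng.2
    ((f.continuous.comp hp).prodMk (pullbackHom G (g.comp f)).continuous_total)))

/-- The two-out-of-six property. -/
theorem of_comp_of_comp {f : C(V, W)} {g : C(W, V)} {G : AbBundle W}
    (hfg : IsHomologyIso (f.comp g) G) (hgf : IsHomologyIso (g.comp f) (G.pullback f)) :
    IsHomologyIso f G :=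
  -- In V → W → V → W the map `f` occurs at both ends with different coefficients, so the two
  -- occurrences cannot be identified and two-out-of-six is used.
  InducesHomologyIso.of_comp_of_comp ((comp_iff f g (G.pullback f)).1 hgf) ((comp_iff g f G).1 hfg)

end IsHomologyIso

/-! ### Parallel transport -/

namespace AbBundle

variable {W X : Type u} [TopologicalSpace W] [TopologicalSpace X]

theorem exists_pt_eq (F : AbBundle X) {v : F.Total} {x : X} (h : v.proj = x) :
    ∃ a : F.fiber x, F.pt x a = v := by
  subst h
  exact ⟨v.snd, rfl⟩

theorem pt_injective (F : AbBundle X) (x : X) : Function.Injective (F.pt x) :=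
  Bundle.TotalSpace.mk_injective x

/-- A sum of two lifts of a path is a lift. -/
theorem continuous_pt_add (F : AbBundle X) (σ : C(unitInterval, X))
    {a b : ∀ t, F.fiber (σ t)} (ha : Continuous fun t => F.pt (σ t) (a t))
    (hb : Continuous fun t => F.pt (σ t) (b t)) :
    Continuous fun t => F.pt (σ t) (a t + b t) := by
  -- `sections` requires a test space in `Type u`.
  let σ' : C(ULift.{u} unitInterval, X) := σ.comp ⟨ULift.down, continuous_uliftDown⟩
  have := (F.sections σ').add_mem (x := fun t => a t.down) (y := fun t => b t.down)
    (ha.comp continuous_uliftDown) (hb.comp continuous_uliftDown)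
  exact (show Continuous fun t => F.pt (σ' t) (a t.down + b t.down) from this).comp
    continuous_uliftUp

/-- Lifts of a path agreeing at one time agree always. -/
theorem eq_of_apply_eq (F : AbBundle X) (σ : C(unitInterval, X))
    {a b : ∀ t, F.fiber (σ t)} (ha : Continuous fun t => F.pt (σ t) (a t))
    (hb : Continuous fun t => F.pt (σ t) (b t)) {t₀ : unitInterval} (h : a t₀ = b t₀)
    (t : unitInterval) : a t = b t :=
  F.pt_injective _ (congrFun (F.isCoveringMap.eq_of_comp_eq ha hb rfl t₀
    (congrArg (F.pt (σ t₀)) h)) t)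

/-- There is a lift of a path through every point over the path. -/
theorem exists_lift (F : AbBundle X) (σ : C(unitInterval, X)) (t₀ : unitInterval)
    (v : F.fiber (σ t₀)) :
    ∃ a : ∀ t, F.fiber (σ t), Continuous (fun t => F.pt (σ t) (a t)) ∧ a t₀ = v := by
  have : ContractibleSpace unitInterval :=
    (convex_Icc (0 : ℝ) 1).contractibleSpace ⟨0, unitInterval.zero_mem⟩
  have : LocallyPathConnectedSpace unitInterval :=
    (convex_Icc (0 : ℝ) 1).locallyPathConnectedSpace
  obtain ⟨Γ, ⟨h₁, h₂⟩, -⟩ :=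
    F.isCoveringMap.existsUnique_continuousMap_lifts σ t₀ (F.pt (σ t₀) v) rfl
  choose a ha using fun t => F.exists_pt_eq (congrFun h₂ t)
  exact ⟨a, Γ.continuous.congr fun t => (ha t).symm, F.pt_injective _ ((ha t₀).trans h₁)⟩

/-- Parallel transport along a homotopy `K`. -/
theorem exists_transport (G : AbBundle X) (K : C(unitInterval × W, X)) :
    ∃ T : ∀ (t : unitInterval) (w : W), G.fiber (K (0, w)) ≃+ G.fiber (K (t, w)),
      Continuous fun p : unitInterval ×
          (G.pullback (K.comp (.prodMk (.const W 0) (.id W)))).Total =>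
        G.pt (K (p.1, p.2.proj)) (T p.1 p.2.proj p.2.snd) := by
  let F := G.pullback (K.comp (.prodMk (.const W 0) (.id W)))
  -- Lifting a single homotopy defined on the whole total space transports all vectors at once and
  -- makes transport jointly continuous.
  let H : C(unitInterval × F.Total, X) :=
    K.comp (.prodMk .fst ⟨fun p => p.2.proj, F.continuous_proj.comp continuous_snd⟩)
  let f : C(F.Total, G.Total) :=
    ⟨fun v => G.pt (K (0, v.proj)) v.snd, (CoeffSpace.pullbackHom G _).continuous_total⟩
  let L := G.isCoveringMap.liftHomotopy H f fun _ => rfl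
  have hL : ∀ t w v, (L (t, F.pt w v)).proj = K (t, w) := fun t w v =>
    congrFun (G.isCoveringMap.liftHomotopy_lifts H f fun _ => rfl) (t, F.pt w v)
  choose T hT using fun t w v => G.exists_pt_eq (hL t w v)
  have hT₀ : ∀ w v, T 0 w v = v := fun w v => G.pt_injective _ <| (hT 0 w v).trans <|
    G.isCoveringMap.liftHomotopy_zero H f (fun _ => rfl) (F.pt w v)
  let σ : W → C(unitInterval, X) := fun w => K.comp (.prodMk (.id _) (.const _ w))
  have hc : ∀ w v, Continuous fun t => G.pt (σ w t) (T t w v) := fun w v =>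
    (L.continuous.comp (.prodMk_left (F.pt w v))).congr fun t => (hT t w v).symm
  -- Both sides are lifts of the same path with the same value at time 0.
  have hadd : ∀ t w v v', T t w (v + v') = T t w v + T t w v' := fun t w v v' =>
    G.eq_of_apply_eq (σ w) (hc w (v + v')) (G.continuous_pt_add (σ w) (hc w v) (hc w v'))
      (t₀ := 0) (((hT₀ w _).trans (congrArg₂ _ (hT₀ w v).symm (hT₀ w v').symm))) t
  -- A lift is determined by its value at time t, and one exists through each point over time t.
  have hbij : ∀ t w, Function.Bijective (T t w) := by
    refine fun t w => ⟨fun v v' h => ?_, fun e => ?_⟩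
    · rw [← hT₀ w v, ← hT₀ w v']
      exact G.eq_of_apply_eq (σ w) (hc w v) (hc w v') h 0
    · obtain ⟨a, ha, hat⟩ := G.exists_lift (σ w) t e
      refine ⟨a 0, Eq.trans ?_ hat⟩
      exact G.eq_of_apply_eq (σ w) (hc w (a 0)) ha (hT₀ w (a 0)) t
  refine ⟨fun t w => AddEquiv.ofBijective (AddMonoidHom.mk' (T t w) (hadd t w)) (hbij t w), ?_⟩
  exact L.continuous.congr fun p => (hT p.1 p.2.proj p.2.snd).symm

end AbBundle

/-! ### Homotopy invariance of homology with local coefficients -/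

namespace IsHomologyIso

open CoeffSpace

variable {W X : Type u} [TopologicalSpace W] [TopologicalSpace X]

/-- Parallel transport extends the homotopy to a morphism from the cylinder on (W, f₀^*G) to (X, G).
Its restrictions to the two ends cover f₀ and f₁, and the two end inclusions agree on homology. -/
theorem iff_of_homotopic {f₀ f₁ : C(W, X)} (h : f₀.Homotopic f₁) (G : AbBundle X) :
    IsHomologyIso f₀ G ↔ IsHomologyIso f₁ G := by
  obtain ⟨K⟩ := h
  obtain ⟨T, hT⟩ := G.exists_transport K.toContinuousMap
  let F := G.pullback (K.toContinuousMap.comp (.prodMk (.const W 0) (.id W)))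
  let Φ : (of F).cylinder ⟶ of G :=
    { map := K.toContinuousMap.comp ContinuousMap.prodSwap
      fiberMap := fun p => T p.2 p.1
      continuous_total := by
        have hp := (of F).cylinder.coeff.continuous_proj
        exact hT.comp ((continuous_snd.comp hp).prodMk
          (pullbackHom F (ContinuousMap.fst : C(W × unitInterval, W))).continuous_total) }
  have key : InducesHomologyIso ((of F).cylinderInclusion 0 ≫ Φ) ↔
      InducesHomologyIso ((of F).cylinderInclusion 1 ≫ Φ) := by
    simp only [InducesHomologyIso, Functor.map_comp, homology_map_cylinderInclusion]
  rw [inducesHomologyIso_iff (F := F), inducesHomologyIso_iff (F := F)] at key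
  have h₀ : (show C(W, X) from ((of F).cylinderInclusion 0 ≫ Φ).map) = f₀ :=
    ContinuousMap.ext K.apply_zero
  have h₁ : (show C(W, X) from ((of F).cylinderInclusion 1 ≫ Φ).map) = f₁ :=
    ContinuousMap.ext K.apply_one
  rw [← h₀, ← h₁]
  exact key

theorem of_homotopyInverse {f : C(W, X)} {g : C(X, W)}
    (hfg : (f.comp g).Homotopic (.id X)) (hgf : (g.comp f).Homotopic (.id W)) (G : AbBundle X) :
    IsHomologyIso f G :=
  of_comp_of_comp ((iff_of_homotopic hfg G).2 (id G)) ((iff_of_homotopic hgf _).2 (id _))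

end IsHomologyIso

/-! ### Homotopy fibres over contractible sets -/

section HomotopyFibres

open ContinuousMap unitInterval

section Prepend

variable {W X : Type*}

/-- For `p(1) = γ(0)`, the path which is `γ` on `[0, 1]` and `p`, shifted by one, on `[-1, 0]`,
reparametrized to `[0, 1]` after cutting it off at `-s`. -/
noncomputable def prependPath (p γ : I → X) (s t : I) : X :=
  if (t : ℝ) * (1 + s) - s ≤ 0 then p (Set.projIcc 0 1 zero_le_one (1 + (t * (1 + s) - s)))
  else γ (Set.projIcc 0 1 zero_le_one (t * (1 + s) - s))

theorem prependPath_zero {p γ : I → X} (h : p 1 = γ 0) (t : I) : prependPath p γ 0 t = γ t := by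
  unfold prependPath
  split_ifs with ht
  · have h₀ : t = 0 := le_antisymm (Subtype.coe_le_coe.1 (by simpa using ht)) t.2.1
    simp [h₀, h]
  · simp

theorem prependPath_apply_one (p γ : I → X) (s : I) : prependPath p γ s 1 = γ 1 := by
  simp [prependPath]

theorem prependPath_apply_zero (p γ : I → X) (s : I) :
    prependPath p γ s 0 = p (σ s) := by
  have h : -(s : ℝ) ≤ 0 := neg_nonpos.2 s.2.1
  simp only [prependPath, Set.Icc.coe_zero, zero_mul, zero_sub, h, if_true]
  congr 1
  exact (congrArg _ (sub_eq_add_neg (1 : ℝ) s).symm).trans (Set.projIcc_val zero_le_one (σ s))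

variable [TopologicalSpace W] [TopologicalSpace X]

/-- The two formulas match at the junction because p(1) = γ(0). Continuity in the cut-off s too
makes s a homotopy parameter, from γ at s = 0 to the full concatenation at s = 1. -/
theorem continuous_prependPath {p γ : W → I → X} (hp : Continuous fun x : W × I => p x.1 x.2)
    (hγ : Continuous fun x : W × I => γ x.1 x.2) (h : ∀ w, p w 1 = γ w 0) :
    Continuous fun x : (W × I) × I => prependPath (p x.1.1) (γ x.1.1) x.1.2 x.2 := by
  have ht : Continuous fun x : (W × I) × I => (x.2 : ℝ) * (1 + x.1.2) - x.1.2 := by fun_prop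
  have hw : Continuous fun x : (W × I) × I => x.1.1 := by fun_prop
  refine Continuous.if_le
    (hp.comp (hw.prodMk ((continuous_projIcc (h := zero_le_one)).comp (continuous_const.add ht))))
    (hγ.comp (hw.prodMk ((continuous_projIcc (h := zero_le_one)).comp ht))) ht continuous_const fun x hx => ?_
  simp [hx, h]

end Prepend

/-- A contractible space contracts to any of its points. -/
theorem ContractibleSpace.homotopic_const_id {U : Type*} [TopologicalSpace U]
    [ContractibleSpace U] (z : U) : (ContinuousMap.const U z).Homotopic (.id U) := by
  obtain ⟨y, hy⟩ := id_nullhomotopic U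
  exact (ContinuousMap.Homotopic.trans hy
    (ContinuousMap.homotopic_const_iff.2 (PathConnectedSpace.joined y z))).symm

variable {X Y : Type u} [TopologicalSpace X] [TopologicalSpace Y]

/-- The map to a homotopy fibre given by a continuous family of paths. -/
def mapToHofib {W : Type*} [TopologicalSpace W] (q : C(Y, X)) (U : Set X) (α : C(W × I, X))
    (y : C(W, Y)) (h₀ : ∀ w, α (w, 0) ∈ U) (h₁ : ∀ w, α (w, 1) = q (y w)) : C(W, Hofib q U) where
  toFun w := ⟨(α.curry w, y w), h₀ w, h₁ w⟩
  continuous_toFun := (α.curry.continuous.prodMk y.continuous).subtype_mk _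

/-- The inclusion of homotopy fibres over an inclusion of subsets. -/
def hofibInclusion (q : C(Y, X)) {U V : Set X} (h : U ⊆ V) : C(Hofib q U, Hofib q V) where
  toFun p := ⟨p.1, h p.2.1, p.2.2⟩
  continuous_toFun := continuous_subtype_val.subtype_mk _

theorem continuous_hofib_eval (q : C(Y, X)) (U : Set X) :
    Continuous fun x : Hofib q U × I => x.1.1.1 x.2 := by
  fun_prop

/-- A contraction of `U` to z gives a path in `U` from z to γ(0); prepending it is a homotopy
inverse `g`. Over `U`, cutting off the prepended path (`K`) deforms inclusion ∘ g to the identity.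
Over z, `g` prepends the loop `ℓ` that z traces during the contraction, and cutting this off could
leave the fibre. As `U` is simply connected, the loop is first shrunk with endpoints fixed (`L`),
and the resulting constant path is then removed (`M`). -/
theorem isHomologyIso_hofibInclusion (q : C(Y, X)) (U : Set X) [ContractibleSpace U] {z : X}
    (hz : z ∈ U) (G : AbBundle (Hofib q U)) :
    IsHomologyIso (hofibInclusion q (Set.singleton_subset_iff.2 hz)) G := by
  obtain ⟨c⟩ := ContractibleSpace.homotopic_const_id (⟨z, hz⟩ : U)
  let ℓ : Path (⟨z, hz⟩ : U) ⟨z, hz⟩ :=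
    ⟨⟨fun t => c (t, ⟨z, hz⟩), by fun_prop⟩, c.apply_zero _, c.apply_one _⟩
  obtain ⟨F⟩ := SimplyConnectedSpace.paths_homotopic ℓ (Path.refl _)
  -- prepending the contraction
  let p : Hofib q U → I → X := fun w t => c (t, ⟨w.1.1 0, w.2.1⟩)
  have hp : Continuous fun x : Hofib q U × I => p x.1 x.2 := by
    refine continuous_subtype_val.comp (c.continuous.comp (continuous_snd.prodMk ?_))
    exact Continuous.subtype_mk (by fun_prop) _
  have hp₁ : ∀ w, p w 1 = w.1.1 0 := fun w => congrArg Subtype.val (c.apply_one _)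
  have hp₀ : ∀ w, p w 0 = z := fun w => congrArg Subtype.val (c.apply_zero _)
  have hK := continuous_prependPath hp (continuous_hofib_eval q U) hp₁
  let K : C(Hofib q U × I, Hofib q U) :=
    mapToHofib q U ⟨_, hK⟩ ⟨fun x => x.1.1.2, by fun_prop⟩
      (fun x => by
        change prependPath (p x.1) x.1.1.1 x.2 0 ∈ U
        rw [prependPath_apply_zero]
        exact Subtype.property _)
      (fun x => (prependPath_apply_one (p x.1) x.1.1.1 x.2).trans x.1.2.2)
  let g : C(Hofib q U, Hofib q {z}) :=
    mapToHofib q {z} ⟨fun x => prependPath (p x.1) x.1.1.1 1 x.2,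
        hK.comp (.prodMk (.prodMk continuous_fst continuous_const) continuous_snd)⟩
      ⟨fun x => x.1.2, by fun_prop⟩
      (fun x => (prependPath_apply_zero (p x) x.1.1 1).trans
        ((congrArg (p x) unitInterval.symm_one).trans (hp₀ x)))
      (fun x => (prependPath_apply_one (p x) x.1.1 1).trans x.2.2)
  -- shrinking the loop at the base point
  have hL := continuous_prependPath (W := Hofib q {z} × I)
    (p := fun x t => (F (x.2, t) : X)) (γ := fun x => x.1.1.1)
    (by fun_prop) (by fun_prop) (fun x => by
      simpa using! (Set.mem_singleton_iff.1 x.1.2.1).symm)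
  let L : C(Hofib q {z} × I, Hofib q {z}) :=
    mapToHofib q {z} ⟨fun x => prependPath (fun t => (F (x.1.2, t) : X)) x.1.1.1.1 1 x.2,
        hL.comp (.prodMk (.prodMk continuous_fst continuous_const) continuous_snd)⟩
      ⟨fun x => x.1.1.2, by fun_prop⟩
      (fun x => (prependPath_apply_zero (fun t => (F (x.2, t) : X)) x.1.1.1 1).trans (by simp))
      (fun x => (prependPath_apply_one (fun t => (F (x.2, t) : X)) x.1.1.1 1).trans x.1.2.2)
  have hM := continuous_prependPath (W := Hofib q {z})
    (p := fun _ _ => z) (γ := fun x => x.1.1)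
    (by fun_prop) (by fun_prop) (fun x => (Set.mem_singleton_iff.1 x.2.1).symm)
  let M : C(Hofib q {z} × I, Hofib q {z}) :=
    mapToHofib q {z} ⟨_, hM⟩ ⟨fun x => x.1.1.2, by fun_prop⟩
      (fun x => prependPath_apply_zero (fun _ => z) x.1.1.1 x.2)
      (fun x => (prependPath_apply_one (fun _ => z) x.1.1.1 x.2).trans x.1.2.2)
  refine IsHomologyIso.of_homotopyInverse (g := g) ?_ ?_ G
  · refine (ContinuousMap.Homotopic.symm ⟨⟨K.comp .prodSwap, fun w => ?_, fun w => rfl⟩⟩)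
    exact Subtype.ext (Prod.ext (ContinuousMap.ext fun t => prependPath_zero (hp₁ w) t) rfl)
  · have h₁ : (g.comp (hofibInclusion q (Set.singleton_subset_iff.2 hz))).Homotopic
        (L.comp (.prodMk (.id _) (.const _ 1))) := by
      refine ⟨⟨L.comp .prodSwap, fun w => ?_, fun w => rfl⟩⟩
      refine Subtype.ext (Prod.ext (ContinuousMap.ext fun t => ?_) rfl)
      -- Since w starts at z, the path prepended by `g` is the loop `ℓ`.
      refine congrArg (prependPath · w.1.1 1 t) (funext fun t => ?_ :
        (fun t => (F (0, t) : X)) = p (hofibInclusion q (Set.singleton_subset_iff.2 hz) w))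
      have hw : w.1.1 0 = z := w.2.1
      have : (⟨z, hz⟩ : U) = ⟨w.1.1 0, hw.symm.subst (motive := (· ∈ U)) hz⟩ := Subtype.ext hw.symm
      exact congrArg Subtype.val ((F.apply_zero t).trans (congrArg (fun u => c (t, u)) this))
    refine h₁.trans (ContinuousMap.Homotopic.symm ⟨⟨M.comp .prodSwap, fun w => ?_, fun w => ?_⟩⟩)
    · exact Subtype.ext (Prod.ext (ContinuousMap.ext fun t =>
        prependPath_zero (p := fun _ => z) (γ := w.1.1) (Set.mem_singleton_iff.1 w.2.1).symm t) rfl)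
    · refine Subtype.ext (Prod.ext (ContinuousMap.ext fun t => ?_) rfl)
      refine congrArg (prependPath · w.1.1 1 t) (funext fun t => ?_ :
        (fun _ => z) = fun t => (F (1, t) : X))
      exact (congrArg Subtype.val (F.apply_one t)).symm

/-! ### Factoring through the homotopy fibre of the restriction -/

/-- The natural inclusion `hofib_U(r|_Z) → hofib_U(r)`. -/
def hofibRestrictToHofibImage (r : C(Y, X)) (Z : Set X) (U : Set Z) :
    C(Hofib (r.restrictPreimage Z) U, Hofib r (Subtype.val '' U : Set X)) where
  toFun p := ⟨((⟨Subtype.val, continuous_subtype_val⟩ : C(Z, X)).comp p.1.1, p.1.2),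
    Set.mem_image_of_mem _ p.2.1, congrArg Subtype.val p.2.2⟩
  continuous_toFun := by
    refine Continuous.subtype_mk (Continuous.prodMk ?_ ?_) _
    · exact (ContinuousMap.continuous_postcomp _).comp
        (continuous_fst.comp continuous_subtype_val)
    · exact continuous_subtype_val.comp (continuous_snd.comp continuous_subtype_val)

/-- The natural inclusion `r⁻¹(U) → hofib_U(r|_Z)`, by constant paths. -/
def preimageToHofibRestrict (r : C(Y, X)) (Z : Set X) (U : Set Z) :
    C(r ⁻¹' (Subtype.val '' U : Set X), Hofib (r.restrictPreimage Z) U) where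
  toFun y := ⟨(ContinuousMap.const I ⟨r y, Subtype.coe_image_subset Z U y.2⟩,
      ⟨y, Subtype.coe_image_subset Z U y.2⟩), by
        obtain ⟨z, hz, h⟩ := y.2
        exact (Subtype.ext h : z = ⟨r y, _⟩) ▸ hz, rfl⟩
  continuous_toFun := by
    refine Continuous.subtype_mk (Continuous.prodMk ?_ (continuous_subtype_val.subtype_mk _)) _
    exact ContinuousMap.continuous_const'.comp
      ((r.continuous.comp continuous_subtype_val).subtype_mk _)

/-- For a Serre homology fibration, fibres over `U` map to the homotopy fibre over `U`
of the restriction by homology isomorphisms. -/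
theorem IsSerreHomologyFibration.isHomologyIso_fiberToPreimage_comp
    {𝔠 : ObjectProperty CoeffSpace.{u}} (h𝔠 : ∀ {A B : CoeffSpace.{u}}, (A ⟶ B) → 𝔠 B → 𝔠 A)
    {r : C(Y, X)} {Z : Set X} (hserre : IsSerreHomologyFibration 𝔠 r Z) (U : Set Z)
    [ContractibleSpace U] {z : Z} (hz : z ∈ U) (F : AbBundle (Hofib r (Subtype.val '' U : Set X)))
    (hF : 𝔠 (CoeffSpace.of F)) :
    IsHomologyIso ((preimageToHofibRestrict r Z U).comp (fiberToPreimage r hz))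
      (F.pullback (hofibRestrictToHofibImage r Z U)) := by
  have hm : ({(z : X)} : Set X) ⊆ Subtype.val '' U :=
    Set.singleton_subset_iff.2 (Set.mem_image_of_mem _ hz)
  have h₁ := hserre z (F.pullback (hofibInclusion r hm)) (h𝔠 (CoeffSpace.pullbackHom F _) hF)
  -- Both routes from hofib_z(r|_Z) to hofib_U(r), via hofib_z(r) and via hofib_U(r|_Z), are
  -- definitionally the same map, so the coefficients can be read along the second.
  rw [← IsHomologyIso.pullback_comp_iff] at h₁
  have h₂ : IsHomologyIso (fiberToHofibRestrict r Z z)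
      ((F.pullback (hofibRestrictToHofibImage r Z U)).pullback
        (hofibInclusion _ (Set.singleton_subset_iff.2 hz))) :=
    (IsHomologyIso.pullback_comp_iff _ _ _ _).1 h₁
  have h₃ := (IsHomologyIso.comp_iff_right
    (isHomologyIso_hofibInclusion (r.restrictPreimage Z) U hz _)).2 h₂
  -- One map uses the constant path at r(y), the other the one at z; they agree because y lies over
  -- z.
  convert h₃ using 1
  ext y : 1
  refine Subtype.ext (Prod.ext (ContinuousMap.ext fun t => Subtype.ext ?_) rfl)
  exact y.2

end HomotopyFibres

theorem mainTheorem7 {X Y : Type u} [TopologicalSpace X] [TopologicalSpace Y]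
    (𝔠 : ObjectProperty CoeffSpace.{u})
    (h𝔠 : ∀ {A B : CoeffSpace.{u}}, (A ⟶ B) → 𝔠 B → 𝔠 A)
    (r : C(Y, X)) (Z : Set X)
    (hstalk : IsLocallyStalkLikeOnHomology 𝔠 r Z)
    (hserre : IsSerreHomologyFibration 𝔠 r Z) :
    IsLerayHomologyFibration 𝔠 r Z := by
  obtain ⟨B, hB, hU⟩ := hstalk
  refine ⟨B, hB, fun U hUB => (hU U hUB).1, fun U hUB z hz F hF => ?_⟩
  obtain ⟨_, zU, hzU, hstalkU⟩ := hU U hUB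
  have hq : preimageToHofib r (Subtype.val '' U : Set X) =
      (hofibRestrictToHofibImage r Z U).comp (preimageToHofibRestrict r Z U) := rfl
  have key := fun {z : Z} (hz : z ∈ U) =>
    hserre.isHomologyIso_fiberToPreimage_comp h𝔠 U hz F hF
  have hU₀ := hstalkU F hF
  rw [hq, IsHomologyIso.pullback_comp_iff] at hU₀ ⊢
  -- The inner cancellation at `zU` gives the isomorphism for r⁻¹(U) → hofib_U(r|_Z); the outer one
  -- removes that map at z.
  exact (IsHomologyIso.comp_iff_right
    ((IsHomologyIso.comp_iff_left hU₀).1 (key hzU))).1 (key hz)
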